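/- Let $C=[x_0,x_1]\times[y_0,y_1]\subset\mathbb{R}^2$ with $x_0<x_1$ and $y_0<y_1$ be a rectangular cake, to be divided among $n\ge 1$ agents. Agent $i$ has a value-density $v_i$ that is integrable, non-negative and bounded on $C$; the value of a piece $P\subseteq C$ to agent $i$ is $V_i(P)=\int_P v_i(x)\,dx$, and $V_i(C)>0$. A rectangular allocation is a tuple $X=(X_1,\dots,X_n)$ of pairwise disjoint, possibly empty or degenerate rectangles contained in $C$ with sides parallel to those of $C$ (each rectangle may contain any of its sides or none; the $X_i$ need not cover $C$). For $B>0$, the allocation is $(1/B)$-proportional if $V_i(X_i)\ge \frac{1}{Bn}V_i(C)$ for every $i$. Its utilitarian welfare is $W_{\mathrm{util}}(X)=\frac1n\sum_{i=1}^n V_i(X_i)/V_i(C)$ and its Nash welfare is $W_{\mathrm{Nash}}(X)=\bigl(\prod_{i=1}^n V_i(X_i)/V_i(C)\bigr)^{1/n}$. For a welfare function $W$, the $W$-price of $(1/B)$-proportionality is $$\frac{\max_X W(X)}{\max_Y W(Y)},$$ where $X$ ranges over all rectangular allocations and $Y$ over all $(1/B)$-proportional rectangular allocations. Theorem. For all $B\ge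 4$, all $n\geq 1$ and all $C$ and $v_1,\dots,v_n$ as above, both maxima in this ratio exist and the second one is positive, for $W=W_{\mathrm{util}}$ and for $W=W_{\mathrm{Nash}}$, and: 1. the utilitarian price of $(1/B)$-proportionality is $O(\sqrt n)$: it is at most $K\sqrt n$, where $K$ is an absolute constant (independent of $B$, $n$, $C$ and $v_1,\dots,v_n$); 2. the Nash price of $(1/B)$-proportionality is at most $11.2$. -/

import Mathlib

open MeasureTheory

namespace CakeCutting

/-- `v` is a value-density function on the cake `C`: integrable, non-negative and bounded on `C`. -/
structure IsValueDensity (C : Set (ℝ × ℝ)) (v : ℝ × ℝ → ℝ) : Prop where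
  integrableOn : IntegrableOn v C volume
  nonneg : ∀ x ∈ C, 0 ≤ v x
  bounded : ∃ K : ℝ, ∀ x ∈ C, v x ≤ K

/-- The value of a piece `P` to an agent whose value-density is `v`. -/
noncomputable def value (v : ℝ × ℝ → ℝ) (P : Set (ℝ × ℝ)) : ℝ :=
  ∫ x in P, v x

/-- The family of axes-parallel rectangles: products of two intervals. The intervals may be open,
closed, half-open or empty, so that pieces can be disjoint in the literal sense; the boundary of a
rectangle has area zero and hence value zero. -/
def parallelRectangles : Set (Set (ℝ × ℝ)) :=
  {P | ∃ I J : Set ℝ, I.OrdConnected ∧ J.OrdConnected ∧ P = I ×ˢ J}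

/-- An allocation of the cake `C` to `n` agents: pairwise-disjoint Borel subsets of `C`, one for
each agent. Part of the cake may stay unallocated. -/
def IsAllocation {n : ℕ} (C : Set (ℝ × ℝ)) (X : Fin n → Set (ℝ × ℝ)) : Prop :=
  (∀ i, MeasurableSet (X i)) ∧ (∀ i, X i ⊆ C) ∧ ∀ i j, i ≠ j → Disjoint (X i) (X j)

/-- An allocation in which every piece belongs to the family `S` of usable pieces. -/
def IsUsableAllocation {n : ℕ} (C : Set (ℝ × ℝ)) (S : Set (Set (ℝ × ℝ)))
    (X : Fin n → Set (ℝ × ℝ)) : Prop :=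
  IsAllocation C X ∧ ∀ i, X i ∈ S

/-- `r`-proportionality: every agent gets at least `r / n` of the total cake value. -/
def IsProportional {n : ℕ} (r : ℝ) (C : Set (ℝ × ℝ)) (v : Fin n → ℝ × ℝ → ℝ)
    (X : Fin n → Set (ℝ × ℝ)) : Prop :=
  ∀ i, r / n * value (v i) C ≤ value (v i) (X i)

/-- Utilitarian welfare: the arithmetic mean of the agents' normalized values. -/
noncomputable def utilitarianWelfare {n : ℕ} (C : Set (ℝ × ℝ)) (v : Fin n → ℝ × ℝ → ℝ)
    (X : Fin n → Set (ℝ × ℝ)) : ℝ :=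
  1 / n * ∑ i, value (v i) (X i) / value (v i) C

/-- Nash welfare: the geometric mean of the agents' normalized values. -/
noncomputable def nashWelfare {n : ℕ} (C : Set (ℝ × ℝ)) (v : Fin n → ℝ × ℝ → ℝ)
    (X : Fin n → Set (ℝ × ℝ)) : ℝ :=
  (∏ i, value (v i) (X i) / value (v i) C) ^ (1 / n : ℝ)

/-- `p` is the price of the fairness criterion `F` with respect to the welfare function `W`, for
the cake `C` and the family `S` of usable pieces: the ratio of the maximum of `W` over all usable
allocations to the maximum of `W` over the usable allocations that satisfy `F`. Both maxima have
to be attained (so fair allocations have to exist), and the second one has to be positive. -/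
def IsPriceOfFairness {n : ℕ} (C : Set (ℝ × ℝ)) (S : Set (Set (ℝ × ℝ)))
    (W : (Fin n → Set (ℝ × ℝ)) → ℝ) (F : (Fin n → Set (ℝ × ℝ)) → Prop) (p : ℝ) : Prop :=
  ∃ M D : ℝ,
    IsGreatest {w | ∃ X, IsUsableAllocation C S X ∧ w = W X} M ∧
    IsGreatest {w | ∃ Y, IsUsableAllocation C S Y ∧ F Y ∧ w = W Y} D ∧
    0 < D ∧ p = M / D

end CakeCutting

/-!
Fix an allocation `X`. Sweeping its rectangles from left to right cuts the cake into `3 * n + 1`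
rectangular tiles, some of them empty, such that the pieces of `X` lie in distinct tiles. Let the
agents play the congestion game in which each of them chooses a tile and receives its value divided
by the number of agents who choose it. A maximiser of Rosenthal's potential is an equilibrium, and
a moving knife divides every tile proportionally among those who chose it. Let `Y` be the resulting
allocation.

In equilibrium, agent `i` values no tile at more than `V i (Y i)` times one plus the number of other
agents there. Summed over all tiles this gives `V i C ≤ 4 * n * V i (Y i)`, so `Y` is
`1 / 4`-proportional. For the tile around `X i` it gives `V i (X i) ≤ m i * V i (Y i)`, where
`∑ i, m i ≤ 2 * n` because these tiles are distinct. The utilitarian bound then follows from the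
Cauchy-Schwarz inequality and the Nash bound from the inequality of the means.

The maxima exist by compactness: up to null sets the pieces are traces on the cake of open
rectangles with extended real endpoints, disjointness is a closed condition on the endpoints, and
the values depend continuously on them.
-/

namespace CakeCutting

section Congestion

open Finset Function

variable {N κ : Type*} [Fintype N] [DecidableEq N] [DecidableEq κ]

/-- The number of players other than `a` who choose the resource `j` when each player `b` chooses
`f b`, in a congestion game. -/
def rivals (f : N → κ) (a : N) (j : κ) : ℕ :=
  #{b ∈ univ.erase a | f b = j}

theorem rivals_update (f : N → κ) (a : N) (i : κ) : rivals (update f a i) a = rivals f a := by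
  funext j
  refine congrArg card (filter_congr fun b hb => ?_)
  rw [update_of_ne (ne_of_mem_erase hb)]

theorem card_fiber_eq_rivals_add (f : N → κ) (a : N) (j : κ) :
    #{b | f b = j} = rivals f a j + if j = f a then 1 else 0 := by
  rw [rivals, ← insert_erase (mem_univ a), filter_insert, erase_insert_eq_erase, erase_idem]
  split_ifs with h h' h'
  · exact card_insert_of_notMem (by simp)
  · exact absurd h.symm h'
  · exact absurd h'.symm h
  · rfl

theorem rivals_apply_self_add_one (f : N → κ) (a : N) :
    rivals f a (f a) + 1 = #{b | f b = f a} := by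
  rw [card_fiber_eq_rivals_add f a, if_pos rfl]

theorem sum_rivals_le_card (f : N → κ) {g : N → κ} (hg : Injective g) :
    ∑ a, rivals f a (g a) ≤ Fintype.card N :=
  calc ∑ a, rivals f a (g a) ≤ ∑ a, #{b | f b = g a} :=
        sum_le_sum fun a _ => card_le_card (filter_subset_filter _ (erase_subset _ _))
    _ = ∑ b, #{a | f b = g a} := sum_card_bipartiteAbove_eq_sum_card_bipartiteBelow _
    _ ≤ ∑ _b : N, 1 := sum_le_sum fun b _ => card_le_one.2 fun a ha a' ha' => hg <|
        (mem_filter.1 ha).2.symm.trans (mem_filter.1 ha').2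
    _ = Fintype.card N := by rw [sum_const, smul_eq_mul, mul_one, card_univ]

theorem sum_rivals_add_one [Fintype κ] (f : N → κ) (a : N) :
    ∑ j, rivals f a j + 1 = Fintype.card N := by
  rw [← card_univ, ← card_erase_add_one (mem_univ a)]
  congr 1
  exact (card_eq_sum_card_fiberwise fun _ _ => mem_coe.2 (mem_univ _)).symm

variable {R : Type*} [Field R]

/-- Multiplicative form of Rosenthal's potential. -/
def potential [Fintype κ] (w : N → κ → R) (f : N → κ) : R :=
  (∏ a, w a (f a)) / (∏ j, (#{a | f a = j}).factorial : ℕ)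

theorem potential_eq_mul [Fintype κ] (w : N → κ → R) (f : N → κ) (a : N) :
    potential w f = w a (f a) / (rivals f a (f a) + 1) *
      ((∏ b ∈ univ.erase a, w b (f b)) / (∏ j, (rivals f a j).factorial : ℕ)) := by
  have hfactorial : ∏ j, (#{b | f b = j}).factorial =
      (rivals f a (f a) + 1) * ∏ j, (rivals f a j).factorial := by
    rw [← mul_prod_erase univ _ (mem_univ (f a)), ← mul_prod_erase univ _ (mem_univ (f a)),
      ← mul_assoc, ← Nat.factorial_succ, rivals_apply_self_add_one]
    refine congrArg _ (prod_congr rfl fun j hj => ?_)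
    rw [card_fiber_eq_rivals_add f a, if_neg (ne_of_mem_erase hj), add_zero]
  rw [potential, ← mul_prod_erase univ _ (mem_univ a), hfactorial, div_mul_div_comm]
  push_cast
  rfl

variable [LinearOrder R] [IsStrictOrderedRing R]

/-- A maximiser of the potential is a Nash equilibrium. -/
theorem exists_forall_share_le [Finite κ] {w : N → κ → R} (hw : ∀ a j, 0 ≤ w a j)
    (hpos : ∀ a, ∃ j, 0 < w a j) :
    ∃ f : N → κ, ∀ a j, w a j / (rivals f a j + 1) ≤ w a (f a) / (rivals f a (f a) + 1) := by
  have := Fintype.ofFinite κ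
  choose f₀ hf₀ using hpos
  obtain ⟨f, -, hmax⟩ := exists_max_image univ (potential w) ⟨f₀, mem_univ f₀⟩
  have hfactorial_pos (g : N → κ) : (0 : R) < (∏ j, (#{a | g a = j}).factorial : ℕ) :=
    Nat.cast_pos.2 (prod_pos fun j _ => Nat.factorial_pos _)
  have hpot : 0 < potential w f :=
    (div_pos (prod_pos fun a _ => hf₀ a) (hfactorial_pos f₀)).trans_le (hmax f₀ (mem_univ f₀))
  refine ⟨f, fun a j => ?_⟩
  have hle := hmax (update f a j) (mem_univ _)
  have hrest : ∏ b ∈ univ.erase a, w b (update f a j b) = ∏ b ∈ univ.erase a, w b (f b) :=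
    prod_congr rfl fun b hb => by rw [update_of_ne (ne_of_mem_erase hb)]
  rw [potential_eq_mul w f a] at hpot
  rw [potential_eq_mul w f a, potential_eq_mul w _ a, rivals_update, update_self, hrest] at hle
  exact le_of_mul_le_mul_right hle
    (pos_of_mul_pos_right hpot (div_nonneg (hw a _) (by positivity)))

theorem sum_le_of_forall_share_le [Fintype κ] {w : κ → R} {f : N → κ} {a : N} {c : R}
    (h : ∀ j, w j / (rivals f a j + 1) ≤ c) :
    ∑ j, w j ≤ (Fintype.card N + Fintype.card κ - 1) * c :=
  calc ∑ j, w j ≤ ∑ j, ((rivals f a j : R) + 1) * c :=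
        sum_le_sum fun j _ => (div_le_iff₀' (by positivity)).1 (h j)
    _ = (Fintype.card N + Fintype.card κ - 1) * c := by
        rw [← sum_mul, sum_add_distrib, ← sum_rivals_add_one f a]
        push_cast
        simp only [sum_const, card_univ, nsmul_eq_mul, mul_one]
        ring

end Congestion

section Tiling

open Set Finset Function

variable {X κ κ' : Type*}

/-- `Z` tiles `C`: the tiles, some of which may be empty, are pairwise disjoint and cover `C`. -/
structure IsTiling (C : Set X) (Z : κ → Set X) : Prop where
  pairwise_disjoint : Pairwise (Disjoint on Z)
  iUnion_eq : ⋃ k, Z k = C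

theorem IsTiling.subset {C : Set X} {Z : κ → Set X} (hZ : IsTiling C Z) (k : κ) : Z k ⊆ C :=
  hZ.iUnion_eq ▸ subset_iUnion Z k

theorem IsTiling.eq_of_mem_of_mem {C : Set X} {Z : κ → Set X} (hZ : IsTiling C Z) {k l : κ} {x : X}
    (hk : x ∈ Z k) (hl : x ∈ Z l) : k = l :=
  hZ.pairwise_disjoint.eq (not_disjoint_iff.2 ⟨x, hk, hl⟩)

theorem IsTiling.inter_left {C : Set X} {Z : κ → Set X} (hZ : IsTiling C Z) (D : Set X) :
    IsTiling (D ∩ C) fun k => D ∩ Z k where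
  pairwise_disjoint := hZ.pairwise_disjoint.mono fun _ _ h =>
    h.mono inter_subset_right inter_subset_right
  iUnion_eq := by rw [← inter_iUnion, hZ.iUnion_eq]

theorem IsTiling.prod_left {Y : Type*} {H : Set Y} {Z : κ → Set Y} (hZ : IsTiling H Z)
    (U : Set X) : IsTiling (U ×ˢ H) fun k => U ×ˢ Z k where
  pairwise_disjoint := hZ.pairwise_disjoint.mono fun _ _ h => disjoint_prod.2 (Or.inr h)
  iUnion_eq := by rw [← prod_iUnion, hZ.iUnion_eq]

theorem IsTiling.retile {C R : Set X} {Z : κ → Set X} {T : κ' → Set X} (hZ : IsTiling C Z)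
    (hR : R ⊆ C) (hT : IsTiling R T) : IsTiling C (Sum.elim (fun k => Z k \ R) T) where
  pairwise_disjoint := by
    rintro (k | k) (l | l) hkl
    · exact (hZ.pairwise_disjoint (ne_of_apply_ne Sum.inl hkl)).mono sdiff_subset sdiff_subset
    · exact disjoint_sdiff_left.mono_right (hT.subset l)
    · exact disjoint_sdiff_right.mono_left (hT.subset k)
    · exact hT.pairwise_disjoint (ne_of_apply_ne Sum.inr hkl)
  iUnion_eq := by
    rw [iUnion_sumElim, ← iUnion_sdiff, hZ.iUnion_eq, hT.iUnion_eq, sdiff_union_of_subset hR]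

variable {α β ι : Type*}

theorem ordConnected_union_sUnion [LinearOrder β] {J : Set β} {S : Set (Set β)}
    (hJ : J.OrdConnected) (hS : ∀ T ∈ S, T.OrdConnected) (hmeet : ∀ T ∈ S, (T ∩ J).Nonempty) :
    (J ∪ ⋃₀ S).OrdConnected := by
  have hreach : ∀ x ∈ J ∪ ⋃₀ S, ∃ p ∈ J, uIcc x p ⊆ J ∪ ⋃₀ S := by
    rintro x (hx | ⟨T, hT, hx⟩)
    · exact ⟨x, hx, (hJ.uIcc_subset hx hx).trans subset_union_left⟩
    · obtain ⟨p, hpT, hpJ⟩ := hmeet T hT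
      exact ⟨p, hpJ, ((hS T hT).uIcc_subset hx hpT).trans
        ((subset_sUnion_of_mem hT).trans subset_union_right)⟩
  refine ordConnected_iff_uIcc_subset.2 fun x hx y hy => ?_
  obtain ⟨p, hpJ, hp⟩ := hreach x hx
  obtain ⟨q, hqJ, hq⟩ := hreach y hy
  calc uIcc x y ⊆ uIcc x p ∪ (uIcc p q ∪ uIcc q y) :=
        uIcc_subset_uIcc_union_uIcc.trans (union_subset_union_right _ uIcc_subset_uIcc_union_uIcc)
    _ ⊆ J ∪ ⋃₀ S := union_subset hp <| union_subset
        ((hJ.uIcc_subset hpJ hqJ).trans subset_union_left) (uIcc_comm q y ▸ hq)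

theorem isTiling_trisection [LinearOrder β] {H J : Set β} (hJ : J.OrdConnected) (hJH : J ⊆ H)
    (hne : H.Nonempty → J.Nonempty) :
    IsTiling H ![J, H \ lowerClosure J, H \ upperClosure J] := by
  have hcover : H ⊆ lowerClosure J ∪ upperClosure J := fun x hx => by
    obtain ⟨y, hy⟩ := hne ⟨x, hx⟩
    exact (le_total x y).imp (fun h => ⟨y, hy, h⟩) fun h => ⟨y, hy, h⟩
  have hmem {x : β} (hl : x ∈ lowerClosure J) (hu : x ∈ upperClosure J) : x ∈ J :=
    hJ.upperClosure_inter_lowerClosure.le ⟨hu, hl⟩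
  refine ⟨?_, ?_⟩
  · have hlower : Disjoint J (H \ lowerClosure J) :=
      disjoint_sdiff_right.mono_left subset_lowerClosure
    have hupper : Disjoint J (H \ upperClosure J) :=
      disjoint_sdiff_right.mono_left subset_upperClosure
    have hsides : Disjoint (H \ lowerClosure J) (H \ upperClosure J) :=
      disjoint_left.2 fun x hx hx' => (hcover hx.1).elim hx.2 hx'.2
    exact (pairwise_disjoint_on _).2 (by simp [Fin.forall_fin_succ, hlower, hupper, hsides])
  · refine (iUnion_subset ?_).antisymm fun x hx => ?_
    · simp [Fin.forall_fin_succ, hJH]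
    · by_cases hl : x ∈ lowerClosure J
      · by_cases hu : x ∈ upperClosure J
        · exact mem_iUnion_of_mem 0 (hmem hl hu)
        · exact mem_iUnion_of_mem 2 ⟨hx, hu⟩
      · exact mem_iUnion_of_mem 1 ⟨hx, hl⟩

/-- A rectangular tiling `P k ×ˢ Q k` of the plane obtained by sweeping the rectangles `I i ×ˢ J i`,
`i ∈ s`, from left to right: the rectangle `i` lies in the tile `own i`, of the same height, and
every tile that meets an up-set to the right of all left sides extends over all of it. -/
structure IsSweepTiling [Preorder α] [Preorder β] (I : ι → Set α) (J : ι → Set β)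
    (s : Finset ι) (P : κ → Set α) (Q : κ → Set β) (own : ι → κ) : Prop where
  ordConnected_fst : ∀ k, (P k).OrdConnected
  ordConnected_snd : ∀ k, (Q k).OrdConnected
  isTiling : IsTiling univ fun k => P k ×ˢ Q k
  injOn_own : Set.InjOn own s
  subset_own : ∀ i ∈ s, I i ⊆ P (own i)
  own_eq : ∀ i ∈ s, Q (own i) = J i
  disjoint_or_subset : ∀ U : Set α, (∀ i ∈ s, U ⊆ upperClosure (I i)) →
    ∀ k, Disjoint (P k) U ∨ U ⊆ P k

/-- The tile `k` is hit when the rectangle `U ×ˢ J` is added to a sweep tiling: it extends over the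
whole base `U` and its row meets `J`. -/
def IsHit (P : κ → Set α) (Q : κ → Set β) (U : Set α) (J : Set β) (k : κ) : Prop :=
  U ⊆ P k ∧ (Q k ∩ J).Nonempty

/-- The height of the block of tiles that has to be retiled around the rectangle `U ×ˢ J`. -/
def band (P : κ → Set α) (Q : κ → Set β) (U : Set α) (J : Set β) : Set β :=
  J ∪ ⋃₀ (Q '' {k | IsHit P Q U J k})

/-- Bases of the tiles after retiling the block `U ×ˢ band P Q U J` by the rectangle `U ×ˢ J` and
the blanks above and below it. -/
def sweepFst (P : κ → Set α) (Q : κ → Set β) (U : Set α) (J : Set β) : κ ⊕ Fin 3 → Set α :=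
  Sum.elim (fun k => P k \ {x ∈ U | IsHit P Q U J k}) fun _ => U

/-- Heights of the tiles with bases `sweepFst P Q U J`. -/
def sweepSnd [Preorder β] (P : κ → Set α) (Q : κ → Set β) (U : Set α) (J : Set β) :
    κ ⊕ Fin 3 → Set β :=
  Sum.elim Q ![J, band P Q U J \ lowerClosure J, band P Q U J \ upperClosure J]

section Sweep

variable {P : κ → Set α} {Q : κ → Set β} {U : Set α} {J : Set β}

theorem ordConnected_band [LinearOrder β] (hQ : ∀ k, (Q k).OrdConnected) (hJ : J.OrdConnected) :
    (band P Q U J).OrdConnected :=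
  ordConnected_union_sUnion hJ (forall_mem_image.2 fun k _ => hQ k)
    (forall_mem_image.2 fun _ hk => hk.2)

theorem ordConnected_sweepFst [LinearOrder α] (hP : ∀ k, (P k).OrdConnected) (hU : IsUpperSet U) :
    ∀ k, (sweepFst P Q U J k).OrdConnected := by
  rintro (k | -)
  · have hblocked : IsUpperSet {x ∈ U | IsHit P Q U J k} := fun _ _ hxy hx => ⟨hU hxy hx.1, hx.2⟩
    exact (hP k).inter hblocked.compl.ordConnected
  · exact hU.ordConnected

theorem disjoint_or_subset_sweepFst {V : Set α} (hVU : V ⊆ U)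
    (hPV : ∀ k, Disjoint (P k) V ∨ V ⊆ P k) :
    ∀ k, Disjoint (sweepFst P Q U J k) V ∨ V ⊆ sweepFst P Q U J k := by
  rintro (k | -)
  · by_cases hhit : IsHit P Q U J k
    · exact Or.inl (disjoint_left.2 fun x hx hxV => hx.2 ⟨hVU hxV, hhit⟩)
    · exact (hPV k).imp (Disjoint.mono_left sdiff_subset) fun hVk x hx =>
        ⟨hVk hx, fun hx' => hhit hx'.2⟩
  · exact Or.inr hVU

theorem ordConnected_sweepSnd [LinearOrder β] (hQ : ∀ k, (Q k).OrdConnected) (hJ : J.OrdConnected) :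
    ∀ k, (sweepSnd P Q U J k).OrdConnected := by
  have hband : (band P Q U J).OrdConnected := ordConnected_band hQ hJ
  rintro (k | k)
  · exact hQ k
  · fin_cases k
    · exact hJ
    · exact hband.inter (lowerClosure J).lower.compl.ordConnected
    · exact hband.inter (upperClosure J).upper.compl.ordConnected

theorem isTiling_sweep [LinearOrder β] (h : IsTiling univ fun k => P k ×ˢ Q k)
    (hPU : ∀ k, Disjoint (P k) U ∨ U ⊆ P k) (hJ : J.OrdConnected) :
    IsTiling univ fun k => sweepFst P Q U J k ×ˢ sweepSnd P Q U J k := by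
  have htrisection := isTiling_trisection hJ (subset_union_left : J ⊆ band P Q U J) <| by
    rintro ⟨y, hy | ⟨_, ⟨k, hk, rfl⟩, -⟩⟩
    exacts [⟨y, hy⟩, hk.2.right]
  have hcell (k : κ) : (P k \ {x ∈ U | IsHit P Q U J k}) ×ˢ Q k =
      P k ×ˢ Q k \ U ×ˢ band P Q U J := by
    ext ⟨x, y⟩
    simp only [mem_prod, mem_sdiff, mem_sep_iff, not_and]
    refine ⟨fun ⟨⟨hx, hxU⟩, hy⟩ => ⟨⟨hx, hy⟩, fun hx' => ?_⟩, fun ⟨⟨hx, hy⟩, hxy⟩ =>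
      ⟨⟨hx, fun hxU hk => hxy hxU (Or.inr ⟨Q k, ⟨k, hk, rfl⟩, hy⟩)⟩, hy⟩⟩
    have hUk : U ⊆ P k := (hPU k).resolve_left (not_disjoint_iff.2 ⟨x, hx, hx'⟩)
    rintro (hyJ | ⟨_, ⟨l, hl, rfl⟩, hyl⟩)
    · exact hxU hx' ⟨hUk, y, hy, hyJ⟩
    · have hkl : k = l := h.eq_of_mem_of_mem (x := (x, y)) ⟨hx, hy⟩ ⟨hl.1 hx', hyl⟩
      exact hxU hx' (hkl ▸ hl)
  convert h.retile (subset_univ _) (htrisection.prod_left U) using 1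
  ext1 (k | k)
  exacts [hcell k, rfl]

theorem disjoint_upperClosure_of_disjoint_prod [Preorder α] {I I' : Set α} {J J' : Set β}
    (hI : I.OrdConnected) (hle : upperClosure I ≤ upperClosure I')
    (hdisj : Disjoint (I ×ˢ J) (I' ×ˢ J')) (hJ : (J ∩ J').Nonempty) :
    Disjoint I (upperClosure I') := by
  refine disjoint_left.2 fun x hx ⟨u, hu, hux⟩ => ?_
  obtain ⟨w, hw, hwu⟩ := hle (subset_upperClosure hu)
  have hIne : (I ∩ I').Nonempty := ⟨u, hI.out hw hx ⟨hwu, hux⟩, hu⟩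
  exact not_disjoint_iff_nonempty_inter.2 (prod_inter_prod ▸ hIne.prod hJ) hdisj

theorem IsSweepTiling.insert [LinearOrder α] [LinearOrder β] [DecidableEq ι]
    {I : ι → Set α} {J : ι → Set β} {s : Finset ι} {a : ι} {P : κ → Set α} {Q : κ → Set β}
    {own : ι → κ} (h : IsSweepTiling I J s P Q own) (ha : a ∉ s) (hI : ∀ i ∈ s, (I i).OrdConnected)
    (hJ : (J a).OrdConnected) (hmax : ∀ i ∈ s, upperClosure (I i) ≤ upperClosure (I a))
    (hdisj : ∀ i ∈ s, Disjoint (I i ×ˢ J i) (I a ×ˢ J a)) :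
    IsSweepTiling I J (insert a s) (sweepFst P Q (upperClosure (I a)) (J a))
      (sweepSnd P Q (upperClosure (I a)) (J a)) (update (Sum.inl ∘ own) a (Sum.inr 0)) := by
  have hne : ∀ i ∈ s, i ≠ a := fun i hi => ne_of_mem_of_not_mem hi ha
  have hPU := h.disjoint_or_subset (upperClosure (I a)) hmax
  refine ⟨ordConnected_sweepFst h.ordConnected_fst (upperClosure (I a)).upper,
    ordConnected_sweepSnd h.ordConnected_snd hJ, isTiling_sweep h.isTiling hPU hJ,
    ?_, ?_, ?_, ?_⟩
  · rw [Finset.coe_insert, injOn_insert (by exact ha)]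
    constructor
    · intro i hi j hj hij
      rw [update_of_ne (hne i hi), update_of_ne (hne j hj)] at hij
      exact h.injOn_own hi hj (Sum.inl_injective hij)
    · rintro ⟨i, hi, hia⟩
      rw [update_of_ne (hne i hi), update_self] at hia
      exact Sum.inl_ne_inr hia
  · refine Finset.forall_mem_insert _ _ _ |>.2 ⟨?_, fun i hi x hx => ?_⟩
    · rw [update_self]
      exact subset_upperClosure
    · rw [update_of_ne (hne i hi)]
      exact ⟨h.subset_own i hi hx, fun ⟨hxU, hhit⟩ => disjoint_left.1
        (disjoint_upperClosure_of_disjoint_prod (hI i hi) (hmax i hi) (hdisj i hi)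
          (h.own_eq i hi ▸ hhit.2)) hx hxU⟩
  · refine Finset.forall_mem_insert _ _ _ |>.2 ⟨?_, fun i hi => ?_⟩
    · rw [update_self]
      rfl
    · rw [update_of_ne (hne i hi)]
      exact h.own_eq i hi
  · intro V hV
    obtain ⟨hVa, hVs⟩ := (Finset.forall_mem_insert _ _ _).1 hV
    exact disjoint_or_subset_sweepFst hVa (h.disjoint_or_subset V hVs)

theorem isSweepTiling_empty [Preorder α] [Preorder β] (I : ι → Set α) (J : ι → Set β) :
    IsSweepTiling I J ∅ (fun _ : Unit => univ) (fun _ => univ) fun _ => () where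
  ordConnected_fst _ := ordConnected_univ
  ordConnected_snd _ := ordConnected_univ
  isTiling := ⟨Subsingleton.pairwise, by rw [univ_prod_univ]; exact iUnion_const _⟩
  injOn_own := by simp
  subset_own := by simp
  own_eq := by simp
  disjoint_or_subset _ _ _ := Or.inr (subset_univ _)

theorem exists_isSweepTiling [LinearOrder α] [LinearOrder β] {I : ι → Set α} {J : ι → Set β}
    (hI : ∀ i, (I i).OrdConnected) (hJ : ∀ i, (J i).OrdConnected)
    (hdisj : Pairwise (Disjoint on fun i => I i ×ˢ J i)) (s : Finset ι) :
    ∃ (κ : Type) (_ : Fintype κ) (P : κ → Set α) (Q : κ → Set β) (own : ι → κ),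
      Fintype.card κ = 3 * #s + 1 ∧ IsSweepTiling I J s P Q own := by
  classical
  induction s using Finset.induction_on_max_value fun i => upperClosure (I i) with
  | empty => exact ⟨Unit, inferInstance, _, _, _, rfl, isSweepTiling_empty I J⟩
  | insert a s ha hmax ih =>
    obtain ⟨κ, _, P, Q, own, hcard, h⟩ := ih
    refine ⟨κ ⊕ Fin 3, inferInstance, _, _, _, ?_, h.insert ha (fun i _ => hI i) (hJ a) hmax
      fun i hi => hdisj (ne_of_mem_of_not_mem hi ha)⟩
    rw [Fintype.card_sum, Fintype.card_fin, hcard, Finset.card_insert_of_notMem ha]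
    ring

end Sweep

end Tiling

section Intervals

open Set Filter Topology

/-- The open interval of reals with endpoints `p.1` and `p.2`. The endpoints are extended reals so
that the intervals are parametrized by a compact space. -/
def extIoo (p : EReal × EReal) : Set ℝ :=
  Real.toEReal ⁻¹' Ioo p.1 p.2

theorem ordConnected_extIoo (p : EReal × EReal) : (extIoo p).OrdConnected :=
  ordConnected_Ioo.preimage_mono EReal.coe_strictMono.monotone

theorem measurableSet_extIoo (p : EReal × EReal) : MeasurableSet (extIoo p) :=
  (ordConnected_extIoo p).measurableSet

theorem isOpen_setOf_mem_extIoo (x : ℝ) : IsOpen {p | x ∈ extIoo p} :=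
  (isOpen_lt continuous_fst continuous_const).inter (isOpen_lt continuous_const continuous_snd)

theorem ae_coe_ne (ν : Measure ℝ) [NullSingletonClass ν] (c : EReal) :
    ∀ᵐ x : ℝ ∂ν, (x : EReal) ≠ c := by
  have hc : {x : ℝ | (x : EReal) = c}.Subsingleton := fun x hx y hy =>
    EReal.coe_injective (hx.trans hy.symm)
  exact hc.countable.ae_notMem ν

theorem exists_extIoo_subset_ae_eq (ν : Measure ℝ) [NullSingletonClass ν] {I : Set ℝ}
    (hI : I.OrdConnected) :
    ∃ p, extIoo p ⊆ I ∧ extIoo p =ᵐ[ν] I := by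
  let p : EReal × EReal := (sInf (Real.toEReal '' I), sSup (Real.toEReal '' I))
  have hsub : extIoo p ⊆ I := by
    rintro x ⟨hl, hr⟩
    obtain ⟨_, ⟨a, ha, rfl⟩, hax⟩ := sInf_lt_iff.1 hl
    obtain ⟨_, ⟨b, hb, rfl⟩, hxb⟩ := lt_sSup_iff.1 hr
    exact hI.out ha hb ⟨(EReal.coe_lt_coe_iff.1 hax).le,
      (EReal.coe_lt_coe_iff.1 hxb).le⟩
  have hsup : I ≤ᵐ[ν] extIoo p := by
    filter_upwards [ae_coe_ne ν p.1, ae_coe_ne ν p.2] with x hl hr hx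
    exact ⟨(sInf_le (mem_image_of_mem _ hx)).lt_of_ne' hl,
      (le_sSup (mem_image_of_mem _ hx)).lt_of_ne hr⟩
  exact ⟨p, hsub, hsub.eventuallyLE.antisymm hsup⟩

theorem eventually_const_lt_iff {X α : Type*} [TopologicalSpace X] [LinearOrder α]
    [TopologicalSpace α] [OrderClosedTopology α] {f : X → α} {p : X} {c : α}
    (hf : ContinuousAt f p) (hc : c ≠ f p) : ∀ᶠ q in 𝓝 p, (c < f q ↔ c < f p) := by
  rcases hc.lt_or_gt with h | h
  · filter_upwards [hf.eventually_const_lt h] with q hq using iff_of_true hq h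
  · filter_upwards [hf.eventually_lt_const h] with q hq using iff_of_false hq.asymm h.asymm

theorem eventually_lt_const_iff {X α : Type*} [TopologicalSpace X] [LinearOrder α]
    [TopologicalSpace α] [OrderClosedTopology α] {f : X → α} {p : X} {c : α}
    (hf : ContinuousAt f p) (hc : c ≠ f p) : ∀ᶠ q in 𝓝 p, (f q < c ↔ f p < c) :=
  eventually_const_lt_iff (α := αᵒᵈ) hf hc

theorem ae_eventually_mem_extIoo_iff (ν : Measure ℝ) [NullSingletonClass ν] (p : EReal × EReal) :
    ∀ᵐ x ∂ν, ∀ᶠ q in 𝓝 p, (x ∈ extIoo q ↔ x ∈ extIoo p) := by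
  filter_upwards [ae_coe_ne ν p.1, ae_coe_ne ν p.2] with x hl hr
  filter_upwards [eventually_lt_const_iff continuousAt_fst hl,
    eventually_const_lt_iff continuousAt_snd hr] with q hql hqr using and_congr hql hqr

theorem continuous_measureReal {X Ω : Type*} [TopologicalSpace X] [FirstCountableTopology X]
    [MeasurableSpace Ω] {μ : Measure Ω} [IsFiniteMeasure μ] {S : X → Set Ω}
    (hS : ∀ p, MeasurableSet (S p))
    (h : ∀ p, ∀ᵐ ω ∂μ, ∀ᶠ q in 𝓝 p, (ω ∈ S q ↔ ω ∈ S p)) :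
    Continuous fun p => μ.real (S p) :=
  continuous_iff_continuousAt.2 fun p =>
    (ENNReal.continuousAt_toReal (measure_ne_top μ _)).tendsto.comp
      (tendsto_measure_of_ae_tendsto_indicator_of_isFiniteMeasure (𝓝 p) (hS p) hS (h p))

theorem continuous_measureReal_extIoo (ν : Measure ℝ) [IsFiniteMeasure ν] [NullSingletonClass ν] :
    Continuous fun p => ν.real (extIoo p) :=
  continuous_measureReal measurableSet_extIoo (ae_eventually_mem_extIoo_iff ν)

/-- The open rectangle with sides `extIoo p.1` and `extIoo p.2`. -/
def extRect (p : (EReal × EReal) × (EReal × EReal)) : Set (ℝ × ℝ) :=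
  extIoo p.1 ×ˢ extIoo p.2

theorem isOpen_setOf_mem_extRect (z : ℝ × ℝ) : IsOpen {p | z ∈ extRect p} :=
  ((isOpen_setOf_mem_extIoo z.1).preimage continuous_fst).inter
    ((isOpen_setOf_mem_extIoo z.2).preimage continuous_snd)

theorem extRect_mem_parallelRectangles (p : (EReal × EReal) × (EReal × EReal)) :
    extRect p ∈ parallelRectangles :=
  ⟨_, _, ordConnected_extIoo p.1, ordConnected_extIoo p.2, rfl⟩

theorem isClosed_setOf_pairwise_disjoint_extRect_inter (ι : Type*) (C : Set (ℝ × ℝ)) :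
    IsClosed {p : ι → (EReal × EReal) × (EReal × EReal) |
      Pairwise fun i j => Disjoint (extRect (p i) ∩ C) (extRect (p j) ∩ C)} := by
  have hopen (z : ℝ × ℝ) (i : ι) : IsOpen
      {p : ι → (EReal × EReal) × (EReal × EReal) | z ∈ extRect (p i) ∩ C} :=
    ((isOpen_setOf_mem_extRect z).preimage
      (f := fun p : ι → (EReal × EReal) × (EReal × EReal) => p i) (continuous_apply i)).and
      isOpen_const
  simp only [Pairwise, disjoint_left, ofPred_forall]
  exact isClosed_iInter fun i => isClosed_iInter fun j => isClosed_iInter fun _ =>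
    isClosed_iInter fun z => isClosed_imp (hopen z i) (hopen z j).isClosed_compl

theorem exists_extRect_subset_ae_eq {μ : Measure (ℝ × ℝ)} (hμ : μ ≪ volume)
    {P : Set (ℝ × ℝ)} (hP : P ∈ parallelRectangles) :
    ∃ p, extRect p ⊆ P ∧ extRect p =ᵐ[μ] P := by
  obtain ⟨I, J, hI, hJ, rfl⟩ := hP
  obtain ⟨p, hpI, hp⟩ := exists_extIoo_subset_ae_eq volume hI
  obtain ⟨q, hqJ, hq⟩ := exists_extIoo_subset_ae_eq volume hJ
  exact ⟨(p, q), prod_mono hpI hqJ, hμ.ae_eq (Measure.set_prod_ae_eq hp hq)⟩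

theorem continuous_measureReal_extRect {μ : Measure (ℝ × ℝ)} [IsFiniteMeasure μ]
    (hμ : μ ≪ volume) : Continuous fun p => μ.real (extRect p) := by
  refine continuous_measureReal
    (fun p => (measurableSet_extIoo p.1).prod (measurableSet_extIoo p.2)) fun p => ?_
  have hfst := hμ.ae_le (Measure.quasiMeasurePreserving_fst.ae
    (ae_eventually_mem_extIoo_iff volume p.1))
  have hsnd := hμ.ae_le (Measure.quasiMeasurePreserving_snd.ae
    (ae_eventually_mem_extIoo_iff volume p.2))
  filter_upwards [hfst, hsnd] with z hz₁ hz₂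
  filter_upwards [continuousAt_fst.eventually hz₁, continuousAt_snd.eventually hz₂] with q hq₁ hq₂
    using and_congr hq₁ hq₂

end Intervals

section Rectangles

open Set

theorem inter_mem_parallelRectangles {P R : Set (ℝ × ℝ)} (hP : P ∈ parallelRectangles)
    (hR : R ∈ parallelRectangles) : P ∩ R ∈ parallelRectangles := by
  obtain ⟨I, J, hI, hJ, rfl⟩ := hP
  obtain ⟨I', J', hI', hJ', rfl⟩ := hR
  exact ⟨I ∩ I', J ∩ J', hI.inter hI', hJ.inter hJ', prod_inter_prod⟩

theorem measurableSet_of_mem_parallelRectangles {P : Set (ℝ × ℝ)} (hP : P ∈ parallelRectangles) :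
    MeasurableSet P := by
  obtain ⟨I, J, hI, hJ, rfl⟩ := hP
  exact hI.measurableSet.prod hJ.measurableSet

theorem isCompact_image_isUsableAllocation {n : ℕ} {C : Set (ℝ × ℝ)} (hC : C ∈ parallelRectangles)
    {μ : Fin n → Measure (ℝ × ℝ)} [∀ i, IsFiniteMeasure (μ i)] (hμ : ∀ i, μ i ≪ volume) :
    IsCompact ((fun (X : Fin n → Set (ℝ × ℝ)) i => (μ i).real (X i)) ''
      {X | IsUsableAllocation C parallelRectangles X}) := by
  have hCm : MeasurableSet C := measurableSet_of_mem_parallelRectangles hC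
  have hR (p) : extRect p ∩ C ∈ parallelRectangles :=
    inter_mem_parallelRectangles (extRect_mem_parallelRectangles p) hC
  have hcont : Continuous fun (p : Fin n → _) i => (μ i).real (extRect (p i) ∩ C) := by
    simp only [← measureReal_restrict_apply' hCm]
    have hrestrict (i) : (μ i).restrict C ≪ volume :=
      Measure.restrict_le_self.absolutelyContinuous.trans (hμ i)
    exact continuous_pi fun i =>
      (continuous_measureReal_extRect (hrestrict i)).comp (continuous_apply i)
  convert (isClosed_setOf_pairwise_disjoint_extRect_inter (Fin n) C).isCompact.image hcont using 1
  refine Subset.antisymm ?_ ?_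
  · rintro _ ⟨X, ⟨⟨-, hXC, hdisj⟩, hX⟩, rfl⟩
    choose p hpX hp using fun i => exists_extRect_subset_ae_eq (hμ i) (hX i)
    have hpC (i) : extRect (p i) ∩ C = extRect (p i) := inter_eq_left.2 ((hpX i).trans (hXC i))
    refine ⟨p, fun i j hij => ?_, funext fun i => ?_⟩
    · exact (hdisj i j hij).mono (inter_subset_left.trans (hpX i)) (inter_subset_left.trans (hpX j))
    · exact (congrArg _ (hpC i)).trans (measureReal_congr (hp i))
  · rintro _ ⟨p, hp, rfl⟩
    exact ⟨fun i => extRect (p i) ∩ C, ⟨⟨fun i => measurableSet_of_mem_parallelRectangles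
      (hR (p i)), fun i => inter_subset_right, fun i j hij => hp hij⟩, fun i => hR (p i)⟩, rfl⟩

end Rectangles

section MovingKnife

open Set Function

theorem exists_measureReal_inter_extIoo_bot_eq {ν : Measure ℝ} [IsFiniteMeasure ν]
    [NullSingletonClass ν] {I : Set ℝ} {c : ℝ} (hc : 0 ≤ c)
    (hcI : c ≤ ν.real I) : ∃ t, ν.real (I ∩ extIoo (⊥, t)) = c := by
  have hcont : Continuous fun t => ν.real (I ∩ extIoo (⊥, t)) := by
    simp only [inter_comm I, ← measureReal_restrict_apply (measurableSet_extIoo _)]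
    exact (continuous_measureReal_extIoo (ν.restrict I)).comp (Continuous.prodMk_right ⊥)
  have hbot : extIoo (⊥, ⊥) = ∅ := by simp [extIoo]
  have htop : extIoo (⊥, ⊤) = univ :=
    eq_univ_of_forall fun x => ⟨EReal.bot_lt_coe x, EReal.coe_lt_top x⟩
  refine mem_range_of_exists_le_of_exists_ge hcont ⟨⊥, ?_⟩ ⟨⊤, ?_⟩
  · rwa [hbot, inter_empty, measureReal_empty]
  · rwa [htop, inter_univ]

theorem extIoo_bot_mono : Monotone fun t => extIoo (⊥, t) := fun _ _ h =>
  preimage_mono (Ioo_subset_Ioo_right h)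

theorem ordConnected_sdiff_extIoo_bot {I : Set ℝ} (hI : I.OrdConnected) (t : EReal) :
    (I \ extIoo (⊥, t)).OrdConnected := by
  have hlower : IsLowerSet (extIoo (⊥, t)) := fun x y hyx hx =>
    ⟨EReal.bot_lt_coe y, (EReal.coe_le_coe_iff.2 hyx).trans_lt hx.2⟩
  exact hI.inter hlower.compl.ordConnected

theorem exists_first_piece {N : Type*} [DecidableEq N] {ν : N → Measure ℝ}
    [∀ a, IsFiniteMeasure (ν a)] [∀ a, NullSingletonClass (ν a)] {c : N → ℝ} (hc : ∀ a, 0 ≤ c a)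
    {A : Finset N} (hA : A.Nonempty) {I : Set ℝ} (hI : I.OrdConnected)
    (hAI : ∀ a ∈ A, A.card * c a ≤ (ν a).real I) :
    ∃ a ∈ A, ∃ K ⊆ I, K.OrdConnected ∧ (I \ K).OrdConnected ∧ c a ≤ (ν a).real K ∧
      ∀ b ∈ A.erase a, (A.erase a).card * c b ≤ (ν b).real (I \ K) := by
  have hcut : ∀ a ∈ A, ∃ t, (ν a).real (I ∩ extIoo (⊥, t)) = c a := fun a ha =>
    exists_measureReal_inter_extIoo_bot_eq (hc a) <|
      (le_mul_of_one_le_left (hc a) (Nat.one_le_cast.2 hA.card_pos)).trans (hAI a ha)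
  choose! t ht using hcut
  obtain ⟨a, ha, hfirst⟩ := A.exists_min_image t hA
  refine ⟨a, ha, I ∩ extIoo (⊥, t a), inter_subset_left, hI.inter (ordConnected_extIoo _), ?_,
    (ht a ha).ge, fun b hb => ?_⟩
  · rw [sdiff_self_inter]
    exact ordConnected_sdiff_extIoo_bot hI (t a)
  · obtain ⟨-, hb⟩ := Finset.mem_erase.1 hb
    have hsmall : (ν b).real (I ∩ extIoo (⊥, t a)) ≤ c b :=
      ht b hb ▸ measureReal_mono (inter_subset_inter_right _ (extIoo_bot_mono (hfirst b hb)))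
    have hsplit : (ν b).real (I ∩ extIoo (⊥, t a)) + (ν b).real (I \ extIoo (⊥, t a)) =
        (ν b).real I := measureReal_inter_add_sdiff (measurableSet_extIoo _)
    have hcard : ((A.erase a).card : ℝ) + 1 = A.card :=
      mod_cast Finset.card_erase_add_one ha
    have hAb := hAI b hb
    rw [← hcard] at hAb
    rw [sdiff_self_inter]
    linarith

/-- The moving knife: the player whose cut comes first takes the piece to its left. -/
theorem exists_pairwiseDisjoint_ordConnected_le {N : Type*} {ν : N → Measure ℝ}
    [∀ a, IsFiniteMeasure (ν a)] [∀ a, NullSingletonClass (ν a)] {c : N → ℝ} (hc : ∀ a, 0 ≤ c a)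
    (A : Finset N) {I : Set ℝ} (hI : I.OrdConnected)
    (hAI : ∀ a ∈ A, A.card * c a ≤ (ν a).real I) :
    ∃ T : N → Set ℝ, (A : Set N).PairwiseDisjoint T ∧
      ∀ a ∈ A, (T a).OrdConnected ∧ T a ⊆ I ∧ c a ≤ (ν a).real (T a) := by
  classical
  induction A using Finset.strongInduction generalizing I with | H A ih =>
  obtain rfl | hA := A.eq_empty_or_nonempty
  · exact ⟨fun _ => ∅, by simp, by simp⟩
  obtain ⟨a, ha, K, hKI, hK, hIK, hcK, hrest⟩ := exists_first_piece hc hA hI hAI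
  obtain ⟨T, hdisj, hT⟩ := ih _ (Finset.erase_ssubset ha) hIK hrest
  have hne : ∀ b ∈ A.erase a, b ≠ a := fun b => Finset.ne_of_mem_erase
  refine ⟨update T a K, ?_, ?_⟩
  · rw [← Finset.insert_erase ha, Finset.coe_insert]
    refine PairwiseDisjoint.insert_of_notMem ?_ (Finset.notMem_erase a A) fun b hb => ?_
    · exact fun b hb d hd hbd => by
        simpa only [onFun, update_of_ne (hne b hb), update_of_ne (hne d hd)] using hdisj hb hd hbd
    · rw [update_self, update_of_ne (hne b hb)]
      exact disjoint_sdiff_right.mono_right (hT b hb).2.1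
  · rw [← Finset.insert_erase ha, Finset.forall_mem_insert]
    refine ⟨by rw [update_self]; exact ⟨hK, hKI, hcK⟩, fun b hb => ?_⟩
    rw [update_of_ne (hne b hb)]
    exact ⟨(hT b hb).1, (hT b hb).2.1.trans sdiff_subset, (hT b hb).2.2⟩

end MovingKnife

section Redivision

open Set Function

theorem measureReal_map_fst_restrict {α β : Type*} [MeasurableSpace α] [MeasurableSpace β]
    (μ : Measure (α × β)) {S : Set α} (hS : MeasurableSet S) (T : Set β) :
    ((μ.restrict (univ ×ˢ T)).map Prod.fst).real S = μ.real (S ×ˢ T) := by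
  rw [map_measureReal_apply measurable_fst hS, measureReal_restrict_apply (measurable_fst hS),
    ← prod_univ, prod_inter_prod, inter_univ, univ_inter]

theorem exists_pairwiseDisjoint_parallelRectangles_le {N : Type*} {μ : N → Measure (ℝ × ℝ)}
    [∀ a, IsFiniteMeasure (μ a)] (hμ : ∀ a, μ a ≪ volume) {c : N → ℝ} (hc : ∀ a, 0 ≤ c a)
    (A : Finset N) {R : Set (ℝ × ℝ)} (hR : R ∈ parallelRectangles)
    (hAR : ∀ a ∈ A, A.card * c a ≤ (μ a).real R) :
    ∃ Y : N → Set (ℝ × ℝ), (A : Set N).PairwiseDisjoint Y ∧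
      ∀ a ∈ A, Y a ∈ parallelRectangles ∧ Y a ⊆ R ∧ c a ≤ (μ a).real (Y a) := by
  obtain ⟨I, J, hI, hJ, rfl⟩ := hR
  let ν (a : N) : Measure ℝ := ((μ a).restrict (univ ×ˢ J)).map Prod.fst
  have hν (a : N) : ν a ≪ volume :=
    ((Measure.restrict_le_self.absolutelyContinuous.trans (hμ a)).map measurable_fst).trans
      Measure.quasiMeasurePreserving_fst.absolutelyContinuous
  have (a : N) : NullSingletonClass (ν a) := ⟨fun x => hν a (measure_singleton x)⟩
  obtain ⟨T, hdisj, hT⟩ := exists_pairwiseDisjoint_ordConnected_le (ν := ν) hc A hI fun a ha =>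
    (measureReal_map_fst_restrict (μ a) hI.measurableSet J).symm ▸ hAR a ha
  refine ⟨fun a => T a ×ˢ J, fun a ha b hb hab => ?_, fun a ha => ?_⟩
  · exact disjoint_prod.2 (Or.inl (hdisj ha hb hab))
  · obtain ⟨hTa, hTI, hcT⟩ := hT a ha
    exact ⟨⟨T a, J, hTa, hJ, rfl⟩, prod_mono_left hTI,
      measureReal_map_fst_restrict (μ a) hTa.measurableSet J ▸ hcT⟩

theorem IsTiling.sum_measureReal {α κ : Type*} [Fintype κ] [MeasurableSpace α] {μ : Measure α}
    [IsFiniteMeasure μ] {C : Set α} {Z : κ → Set α} (hZ : IsTiling C Z)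
    (hZm : ∀ k, MeasurableSet (Z k)) : ∑ k, μ.real (Z k) = μ.real C := by
  rw [← measureReal_iUnion_fintype hZ.pairwise_disjoint hZm, hZ.iUnion_eq]

theorem IsUsableAllocation.exists_isTiling {n : ℕ} {C : Set (ℝ × ℝ)} (hC : C ∈ parallelRectangles)
    {X : Fin n → Set (ℝ × ℝ)} (hX : IsUsableAllocation C parallelRectangles X) :
    ∃ (κ : Type) (_ : Fintype κ) (Z : κ → Set (ℝ × ℝ)) (own : Fin n → κ),
      Fintype.card κ = 3 * n + 1 ∧ IsTiling C Z ∧ (∀ k, Z k ∈ parallelRectangles) ∧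
      Injective own ∧ ∀ i, X i ⊆ Z (own i) := by
  obtain ⟨⟨-, hXC, hdisj⟩, hrect⟩ := hX
  choose I J hI hJ hX using hrect
  obtain rfl : X = fun i => I i ×ˢ J i := funext hX
  obtain ⟨κ, hκ, P, Q, own, hcard, h⟩ := exists_isSweepTiling hI hJ hdisj Finset.univ
  refine ⟨κ, hκ, fun k => C ∩ P k ×ˢ Q k, own, by rw [hcard, Finset.card_fin],
    by simpa using h.isTiling.inter_left C, fun k => ?_,
    injOn_univ.1 (by simpa using h.injOn_own), fun i => ?_⟩
  · exact inter_mem_parallelRectangles hC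
      ⟨P k, Q k, h.ordConnected_fst k, h.ordConnected_snd k, rfl⟩
  · exact subset_inter (hXC i) <|
      prod_mono (h.subset_own i (Finset.mem_univ i)) (h.own_eq i (Finset.mem_univ i)).ge

theorem IsTiling.exists_measureReal_pos {α κ : Type*} [Finite κ] [MeasurableSpace α]
    {μ : Measure α} [IsFiniteMeasure μ] {C : Set α} {Z : κ → Set α} (hZ : IsTiling C Z)
    (hZm : ∀ k, MeasurableSet (Z k)) (hC : 0 < μ.real C) : ∃ k, 0 < μ.real (Z k) := by
  have := Fintype.ofFinite κ
  by_contra! hnull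
  exact hC.not_ge <| (hZ.sum_measureReal hZm).symm.trans_le <|
    Finset.sum_nonpos fun k _ => hnull k

theorem exists_isUsableAllocation_share_le {n : ℕ} {κ : Type*} [Finite κ] [DecidableEq κ]
    {C : Set (ℝ × ℝ)} {Z : κ → Set (ℝ × ℝ)} (hZ : IsTiling C Z)
    (hZrect : ∀ k, Z k ∈ parallelRectangles)
    {μ : Fin n → Measure (ℝ × ℝ)} [∀ i, IsFiniteMeasure (μ i)] (hμ : ∀ i, μ i ≪ volume)
    (hpos : ∀ i, 0 < (μ i).real C) :
    ∃ Y, IsUsableAllocation C parallelRectangles Y ∧ ∃ f : Fin n → κ,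
      ∀ i k, (μ i).real (Z k) / (rivals f i k + 1) ≤ (μ i).real (Y i) := by
  have hZm (k : κ) : MeasurableSet (Z k) := measurableSet_of_mem_parallelRectangles (hZrect k)
  obtain ⟨f, hf⟩ := exists_forall_share_le (w := fun i k => (μ i).real (Z k))
    (fun _ _ => measureReal_nonneg) fun i => hZ.exists_measureReal_pos hZm (hpos i)
  let share (i : Fin n) : ℝ := (μ i).real (Z (f i)) / (rivals f i (f i) + 1)
  have hknife (k : κ) : ∀ i ∈ ({i | f i = k} : Finset (Fin n)),
      ({i | f i = k} : Finset (Fin n)).card * share i ≤ (μ i).real (Z k) := by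
    intro i hi
    obtain rfl : f i = k := (Finset.mem_filter.1 hi).2
    rw [← rivals_apply_self_add_one]
    push_cast
    exact (mul_div_cancel₀ _ (by positivity)).le
  choose Y hdisj hY using fun k => exists_pairwiseDisjoint_parallelRectangles_le hμ
    (fun i => show 0 ≤ share i by positivity) _ (hZrect k) (hknife k)
  have hown (i : Fin n) : i ∈ ({j | f j = f i} : Finset (Fin n)) := by simp
  choose hYrect hYZ hYshare using fun i => hY (f i) i (hown i)
  refine ⟨fun i => Y (f i) i, ⟨⟨fun i => ?_, fun i => ?_, fun i j hij => ?_⟩, hYrect⟩, f,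
    fun i k => (hf i k).trans (hYshare i)⟩
  · exact measurableSet_of_mem_parallelRectangles (hYrect i)
  · exact (hYZ i).trans (hZ.subset (f i))
  · by_cases hfij : f i = f j
    · have hj : j ∈ ({j | f j = f i} : Finset (Fin n)) := hfij ▸ hown j
      simpa only [hfij] using hdisj (f i) (Finset.mem_coe.2 (hown i)) (Finset.mem_coe.2 hj) hij
    · exact (hZ.pairwise_disjoint hfij).mono (hYZ i) (hYZ j)

theorem exists_redivision {n : ℕ} {C : Set (ℝ × ℝ)} (hC : C ∈ parallelRectangles)
    {μ : Fin n → Measure (ℝ × ℝ)} [∀ i, IsFiniteMeasure (μ i)] (hμ : ∀ i, μ i ≪ volume)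
    (hpos : ∀ i, 0 < (μ i).real C) {X : Fin n → Set (ℝ × ℝ)}
    (hX : IsUsableAllocation C parallelRectangles X) :
    ∃ Y, IsUsableAllocation C parallelRectangles Y ∧ ∃ m : Fin n → ℝ, (∀ i, 0 ≤ m i) ∧
      ∑ i, m i ≤ 2 * n ∧ ∀ i, (μ i).real C ≤ 4 * n * (μ i).real (Y i) ∧
        (μ i).real (X i) ≤ m i * (μ i).real (Y i) := by
  classical
  obtain ⟨κ, _, Z, own, hcard, hZ, hZrect, hown, hXZ⟩ := hX.exists_isTiling hC
  obtain ⟨Y, hY, f, hf⟩ := exists_isUsableAllocation_share_le hZ hZrect hμ hpos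
  refine ⟨Y, hY, fun i => rivals f i (own i) + 1, fun i => by positivity, ?_,
    fun i => ⟨?_, ?_⟩⟩
  · have hrivals : ∑ i, (rivals f i (own i) : ℝ) ≤ n := by
      exact_mod_cast (sum_rivals_le_card f hown).trans_eq (Fintype.card_fin n)
    rw [Finset.sum_add_distrib, Finset.sum_const, Finset.card_fin, nsmul_one]
    linarith
  · rw [← hZ.sum_measureReal fun k => measurableSet_of_mem_parallelRectangles (hZrect k)]
    refine (sum_le_of_forall_share_le (hf i)).trans_eq ?_
    rw [hcard, Fintype.card_fin]
    push_cast
    ring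
  · exact (measureReal_mono (hXZ i)).trans <|
      (div_le_iff₀' (by positivity)).1 (hf i (own i))

end Redivision

section Values

variable {C P : Set (ℝ × ℝ)} {v : ℝ × ℝ → ℝ}

/-- The measure on the plane that assigns to a piece the value of its part in the cake `C`, for an
agent with value-density `v`. Negative densities count as zero. -/
noncomputable def valueMeasure (C : Set (ℝ × ℝ)) (v : ℝ × ℝ → ℝ) : Measure (ℝ × ℝ) :=
  (volume.restrict C).withDensity fun x => ENNReal.ofReal (v x)

theorem valueMeasure_absolutelyContinuous (C : Set (ℝ × ℝ)) (v : ℝ × ℝ → ℝ) :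
    valueMeasure C v ≪ volume :=
  (withDensity_absolutelyContinuous _ _).trans Measure.restrict_le_self.absolutelyContinuous

theorem isFiniteMeasure_valueMeasure (hv : IntegrableOn v C) :
    IsFiniteMeasure (valueMeasure C v) :=
  isFiniteMeasure_withDensity_ofReal hv.hasFiniteIntegral

theorem valueMeasure_real (hv : IntegrableOn v C) (hv₀ : ∀ x ∈ C, 0 ≤ v x)
    (hP : MeasurableSet P) (hPC : P ⊆ C) : (valueMeasure C v).real P = value v P := by
  rw [value, integral_eq_lintegral_of_nonneg_ae, measureReal_def, valueMeasure,
    withDensity_apply _ hP, Measure.restrict_restrict hP, Set.inter_eq_left.2 hPC]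
  · filter_upwards [ae_restrict_mem hP] with x hx using hv₀ x (hPC hx)
  · exact (hv.mono_set hPC).aestronglyMeasurable

end Values

section Welfare

variable {ι : Type*} {s : Finset ι} {a b m : ι → ℝ}

theorem sum_le_sqrt_mul_sum {c : ℝ} (ha₀ : ∀ i ∈ s, 0 ≤ a i) (ha₁ : ∀ i ∈ s, a i ≤ 1)
    (hb : ∀ i ∈ s, 0 ≤ b i) (hm : ∀ i ∈ s, 0 ≤ m i) (hab : ∀ i ∈ s, a i ≤ m i * b i)
    (hmb : ∑ i ∈ s, m i ≤ c * ∑ i ∈ s, b i) :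
    ∑ i ∈ s, a i ≤ √c * ∑ i ∈ s, b i := by
  have hsum : 0 ≤ ∑ i ∈ s, b i := Finset.sum_nonneg hb
  have hsq : (∑ i ∈ s, a i) ^ 2 ≤ c * (∑ i ∈ s, b i) ^ 2 :=
    calc (∑ i ∈ s, a i) ^ 2 ≤ (∑ i ∈ s, m i) * ∑ i ∈ s, b i :=
          Finset.sum_sq_le_sum_mul_sum_of_sq_le_mul s hm hb fun i hi =>
            (pow_le_of_le_one (ha₀ i hi) (ha₁ i hi) two_ne_zero).trans (hab i hi)
      _ ≤ c * (∑ i ∈ s, b i) * ∑ i ∈ s, b i := mul_le_mul_of_nonneg_right hmb hsum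
      _ = c * (∑ i ∈ s, b i) ^ 2 := by ring
  calc ∑ i ∈ s, a i ≤ √(c * (∑ i ∈ s, b i) ^ 2) := Real.le_sqrt_of_sq_le hsq
    _ = √c * ∑ i ∈ s, b i := by rw [Real.sqrt_mul' _ (sq_nonneg _), Real.sqrt_sq hsum]

theorem prod_rpow_le_mul_prod_rpow (hs : s.Nonempty) (ha : ∀ i ∈ s, 0 ≤ a i)
    (hb : ∀ i ∈ s, 0 ≤ b i) (hm : ∀ i ∈ s, 0 ≤ m i) (hab : ∀ i ∈ s, a i ≤ m i * b i) :
    (∏ i ∈ s, a i) ^ (1 / s.card : ℝ) ≤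
      (∑ i ∈ s, m i) / s.card * (∏ i ∈ s, b i) ^ (1 / s.card : ℝ) := by
  have hgeom : (∏ i ∈ s, m i) ^ (1 / s.card : ℝ) ≤ (∑ i ∈ s, m i) / s.card := by
    simpa using Real.geom_mean_le_arith_mean s (fun _ => 1) m (by simp) (by simpa using hs) hm
  calc (∏ i ∈ s, a i) ^ (1 / s.card : ℝ) ≤ (∏ i ∈ s, m i * b i) ^ (1 / s.card : ℝ) :=
        Real.rpow_le_rpow (Finset.prod_nonneg ha) (Finset.prod_le_prod ha hab) (by positivity)
    _ = (∏ i ∈ s, m i) ^ (1 / s.card : ℝ) * (∏ i ∈ s, b i) ^ (1 / s.card : ℝ) := by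
        rw [Finset.prod_mul_distrib,
          Real.mul_rpow (Finset.prod_nonneg hm) (Finset.prod_nonneg hb)]
    _ ≤ (∑ i ∈ s, m i) / s.card * (∏ i ∈ s, b i) ^ (1 / s.card : ℝ) :=
        mul_le_mul_of_nonneg_right hgeom (Real.rpow_nonneg (Finset.prod_nonneg hb) _)

end Welfare

section Price

variable {n : ℕ} {C : Set (ℝ × ℝ)}

theorem exists_isPriceOfFairness_le {E : Type*} [TopologicalSpace E] {S : Set (Set (ℝ × ℝ))}
    {s : (Fin n → Set (ℝ × ℝ)) → E} (hs : IsCompact (s '' {X | IsUsableAllocation C S X}))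
    (hne : ∃ X : Fin n → Set (ℝ × ℝ), IsUsableAllocation C S X)
    {F : (Fin n → Set (ℝ × ℝ)) → Prop} {Φ : Set E} (hF : ∀ X, F X ↔ s X ∈ Φ) (hΦ : IsClosed Φ)
    {G : E → ℝ} (hG : Continuous G) (hpos : ∀ u ∈ Φ, 0 < G u) {c : ℝ} (hc : 0 ≤ c)
    (hfair : ∀ X, IsUsableAllocation C S X →
      ∃ Y, IsUsableAllocation C S Y ∧ F Y ∧ G (s X) ≤ c * G (s Y)) :
    ∃ p, IsPriceOfFairness C S (fun X => G (s X)) F p ∧ p ≤ c := by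
  obtain ⟨X₀, hX₀⟩ := hne
  obtain ⟨Y₀, hY₀, hFY₀, -⟩ := hfair X₀ hX₀
  obtain ⟨_, ⟨X, hX, rfl⟩, hXmax⟩ := hs.exists_isMaxOn ⟨_, X₀, hX₀, rfl⟩ hG.continuousOn
  obtain ⟨_, ⟨⟨Y, hY, rfl⟩, hYΦ⟩, hYmax⟩ := (hs.inter_right hΦ).exists_isMaxOn
    ⟨_, ⟨Y₀, hY₀, rfl⟩, (hF Y₀).1 hFY₀⟩ hG.continuousOn
  refine ⟨_, ⟨_, _, ⟨⟨X, hX, rfl⟩, ?_⟩, ⟨⟨Y, hY, (hF Y).2 hYΦ, rfl⟩, ?_⟩, hpos _ hYΦ, rfl⟩, ?_⟩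
  · rintro _ ⟨X', hX', rfl⟩
    exact hXmax ⟨X', hX', rfl⟩
  · rintro _ ⟨Y', hY', hFY', rfl⟩
    exact hYmax ⟨⟨Y', hY', rfl⟩, (hF Y').1 hFY'⟩
  · obtain ⟨Y', hY', hFY', hle⟩ := hfair X hX
    exact (div_le_iff₀ (hpos _ hYΦ)).2 <| hle.trans <|
      mul_le_mul_of_nonneg_left (hYmax ⟨⟨Y', hY', rfl⟩, (hF Y').1 hFY'⟩) hc

theorem isUsableAllocation_empty :
    IsUsableAllocation C parallelRectangles fun _ : Fin n => (∅ : Set (ℝ × ℝ)) :=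
  ⟨⟨fun _ => MeasurableSet.empty, fun _ => Set.empty_subset C, fun _ _ _ => disjoint_bot_left⟩,
    fun _ => ⟨∅, ∅, Set.ordConnected_empty, Set.ordConnected_empty, Set.prod_empty.symm⟩⟩

variable {v : Fin n → ℝ × ℝ → ℝ}

/-- The normalized value of the piece of agent `i`, on which the welfare functions depend: the
fraction of the value of the whole cake that the piece represents to that agent. -/
noncomputable def normalizedValue (C : Set (ℝ × ℝ)) (v : Fin n → ℝ × ℝ → ℝ)
    (X : Fin n → Set (ℝ × ℝ)) (i : Fin n) : ℝ :=
  value (v i) (X i) / value (v i) C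

theorem isProportional_iff_le_normalizedValue (hpos : ∀ i, 0 < value (v i) C) {r : ℝ}
    {X : Fin n → Set (ℝ × ℝ)} : IsProportional r C v X ↔ ∀ i, r / n ≤ normalizedValue C v X i :=
  forall_congr' fun i => (le_div_iff₀ (hpos i)).symm

variable (hC : C ∈ parallelRectangles) (hv : ∀ i, IntegrableOn (v i) C)
  (hv₀ : ∀ i, ∀ x ∈ C, 0 ≤ v i x)

include hv hv₀

theorem valueMeasure_real_of_isUsableAllocation {S : Set (Set (ℝ × ℝ))} {X : Fin n → Set (ℝ × ℝ)}
    (hX : IsUsableAllocation C S X) (i : Fin n) :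
    (valueMeasure C (v i)).real (X i) = value (v i) (X i) :=
  valueMeasure_real (hv i) (hv₀ i) (hX.1.1 i) (hX.1.2.1 i)

include hC

theorem isCompact_image_normalizedValue :
    IsCompact (normalizedValue C v '' {X | IsUsableAllocation C parallelRectangles X}) := by
  have (i : Fin n) := isFiniteMeasure_valueMeasure (hv i)
  have hcompact := (isCompact_image_isUsableAllocation hC
    fun i => valueMeasure_absolutelyContinuous C (v i)).image
      (show Continuous fun (u : Fin n → ℝ) i => u i / value (v i) C by fun_prop)
  rw [Set.image_image] at hcompact
  convert hcompact using 1
  exact Set.image_congr fun X hX => funext fun i => congrArg (· / value (v i) C)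
    (valueMeasure_real_of_isUsableAllocation hv hv₀ hX i).symm

theorem normalizedValue_mem_Icc {X : Fin n → Set (ℝ × ℝ)}
    (hX : IsUsableAllocation C parallelRectangles X) (i : Fin n) :
    normalizedValue C v X i ∈ Set.Icc 0 1 := by
  have := isFiniteMeasure_valueMeasure (hv i)
  rw [normalizedValue, ← valueMeasure_real_of_isUsableAllocation hv hv₀ hX,
    ← valueMeasure_real (hv i) (hv₀ i) (measurableSet_of_mem_parallelRectangles hC) subset_rfl]
  exact ⟨by positivity, div_le_one_of_le₀ (measureReal_mono (hX.1.2.1 i)) measureReal_nonneg⟩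

variable (hpos : ∀ i, 0 < value (v i) C)

include hpos

theorem exists_redivision_normalizedValue (hn : 1 ≤ n) {X : Fin n → Set (ℝ × ℝ)}
    (hX : IsUsableAllocation C parallelRectangles X) :
    ∃ Y, IsUsableAllocation C parallelRectangles Y ∧ ∃ m : Fin n → ℝ, (∀ i, 0 ≤ m i) ∧
      ∑ i, m i ≤ 2 * n ∧ ∀ i, 1 / (4 * n) ≤ normalizedValue C v Y i ∧
        normalizedValue C v X i ≤ m i * normalizedValue C v Y i := by
  have (i : Fin n) := isFiniteMeasure_valueMeasure (hv i)
  have hvalC (i : Fin n) : (valueMeasure C (v i)).real C = value (v i) C :=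
    valueMeasure_real (hv i) (hv₀ i) (measurableSet_of_mem_parallelRectangles hC) subset_rfl
  obtain ⟨Y, hY, m, hm, hsum, h⟩ := exists_redivision hC
    (fun i => valueMeasure_absolutelyContinuous C (v i)) (fun i => (hvalC i).symm ▸ hpos i) hX
  simp only [valueMeasure_real_of_isUsableAllocation hv hv₀ hX,
    valueMeasure_real_of_isUsableAllocation hv hv₀ hY, hvalC] at h
  refine ⟨Y, hY, m, hm, hsum, fun i => ⟨?_, ?_⟩⟩
  · rw [normalizedValue, div_le_div_iff₀ (by positivity) (hpos i), one_mul, mul_comm]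
    exact (h i).1
  · rw [normalizedValue, normalizedValue, ← mul_div_assoc]
    exact div_le_div_of_nonneg_right (h i).2 (hpos i).le

theorem exists_price_isProportional_le (hn : 1 ≤ n) {B : ℝ} (hB : 4 ≤ B) {G : (Fin n → ℝ) → ℝ}
    (hG : Continuous G) (hGpos : ∀ u, (∀ i, 0 < u i) → 0 < G u) {c : ℝ} (hc : 0 ≤ c)
    (hGle : ∀ a b m : Fin n → ℝ, (∀ i, a i ∈ Set.Icc 0 1) → (∀ i, 1 / (4 * n) ≤ b i) →
      (∀ i, 0 ≤ m i) → ∑ i, m i ≤ 2 * n → (∀ i, a i ≤ m i * b i) → G a ≤ c * G b) :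
    ∃ p, IsPriceOfFairness C parallelRectangles (fun X => G (normalizedValue C v X))
      (IsProportional (1 / B) C v) p ∧ p ≤ c := by
  refine exists_isPriceOfFairness_le (isCompact_image_normalizedValue hC hv hv₀)
    ⟨_, isUsableAllocation_empty⟩ (Φ := {u | ∀ i, 1 / B / n ≤ u i})
    (fun X => isProportional_iff_le_normalizedValue hpos) ?_ hG
    (fun u hu => hGpos u fun i => lt_of_lt_of_le (by positivity) (hu i)) hc fun X hX => ?_
  · simp only [Set.ofPred_forall]
    exact isClosed_iInter fun i => isClosed_le continuous_const (continuous_apply i)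
  · obtain ⟨Y, hY, m, hm, hsum, h⟩ := exists_redivision_normalizedValue hC hv hv₀ hpos hn hX
    refine ⟨Y, hY, (isProportional_iff_le_normalizedValue hpos).2 fun i => le_trans ?_ (h i).1,
      hGle _ _ m (normalizedValue_mem_Icc hC hv hv₀ hX) (fun i => (h i).1) hm hsum fun i => (h i).2⟩
    rw [div_div]
    gcongr

theorem exists_price_utilitarianWelfare_le (hn : 1 ≤ n) {B : ℝ} (hB : 4 ≤ B) :
    ∃ p, IsPriceOfFairness C parallelRectangles (utilitarianWelfare C v)
      (IsProportional (1 / B) C v) p ∧ p ≤ √(8 * n) := by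
  have : Nonempty (Fin n) := ⟨⟨0, hn⟩⟩
  refine exists_price_isProportional_le hC hv hv₀ hpos hn hB (G := fun u => 1 / n * ∑ i, u i)
    (by fun_prop) (fun u hu => ?_) (Real.sqrt_nonneg _) fun a b m ha hb hm hsum hab => ?_
  · have hu_sum : 0 < ∑ i, u i := Finset.sum_pos (fun i _ => hu i) Finset.univ_nonempty
    positivity
  have hb_sum : 1 / 4 ≤ ∑ i, b i :=
    calc (1 / 4 : ℝ) = ∑ _i : Fin n, 1 / (4 * n : ℝ) := by
          rw [Finset.sum_const, Finset.card_fin, nsmul_eq_mul]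
          field_simp
      _ ≤ ∑ i, b i := Finset.sum_le_sum fun i _ => hb i
  have hmb : ∑ i, m i ≤ 8 * n * ∑ i, b i := by nlinarith
  rw [mul_left_comm]
  gcongr
  exact sum_le_sqrt_mul_sum (fun i _ => (ha i).1) (fun i _ => (ha i).2)
    (fun i _ => le_trans (by positivity) (hb i)) (fun i _ => hm i) (fun i _ => hab i) hmb

theorem exists_price_nashWelfare_le (hn : 1 ≤ n) {B : ℝ} (hB : 4 ≤ B) :
    ∃ p, IsPriceOfFairness C parallelRectangles (nashWelfare C v)
      (IsProportional (1 / B) C v) p ∧ p ≤ 2 := by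
  have : Nonempty (Fin n) := ⟨⟨0, hn⟩⟩
  refine exists_price_isProportional_le hC hv hv₀ hpos hn hB
    (G := fun u => (∏ i, u i) ^ (1 / n : ℝ))
    (Continuous.rpow_const (by fun_prop) fun _ => Or.inr (by positivity))
    (fun u hu => Real.rpow_pos_of_pos (Finset.prod_pos fun i _ => hu i) _) zero_le_two
    fun a b m ha hb hm hsum hab => ?_
  have hb₀ (i : Fin n) : 0 ≤ b i := le_trans (by positivity) (hb i)
  have hprod : (∏ i, a i) ^ (1 / n : ℝ) ≤ (∑ i, m i) / n * (∏ i, b i) ^ (1 / n : ℝ) := by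
    simpa only [Finset.card_fin] using prod_rpow_le_mul_prod_rpow Finset.univ_nonempty
      (fun i _ => (ha i).1) (fun i _ => hb₀ i) (fun i _ => hm i) fun i _ => hab i
  have hmean : (∑ i, m i) / n ≤ 2 := (div_le_iff₀ (by positivity)).2 hsum
  exact hprod.trans <| mul_le_mul_of_nonneg_right hmean <|
    Real.rpow_nonneg (Finset.prod_nonneg fun i _ => hb₀ i) _

end Price

end CakeCutting

open CakeCutting in
theorem theorem9_general {n : ℕ} (hn : 1 ≤ n) {B : ℝ} (hB : 4 ≤ B) {C : Set (ℝ × ℝ)}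
    (hC : C ∈ parallelRectangles) {v : Fin n → ℝ × ℝ → ℝ} (hv : ∀ i, IntegrableOn (v i) C)
    (hv₀ : ∀ i, ∀ x ∈ C, 0 ≤ v i x) (hpos : ∀ i, 0 < value (v i) C) :
    (∃ p, IsPriceOfFairness C parallelRectangles (utilitarianWelfare C v)
      (IsProportional (1 / B) C v) p ∧ p ≤ √(8 * n)) ∧
    ∃ p, IsPriceOfFairness C parallelRectangles (nashWelfare C v)
      (IsProportional (1 / B) C v) p ∧ p ≤ 2 :=
  ⟨exists_price_utilitarianWelfare_le hC hv hv₀ hpos hn hB,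
    exists_price_nashWelfare_le hC hv hv₀ hpos hn hB⟩

theorem theorem9 :
    ∃ K : ℝ, ∀ B : ℝ, 4 ≤ B →
      ∀ n : ℕ, 1 ≤ n →
      ∀ x₀ x₁ y₀ y₁ : ℝ, x₀ < x₁ → y₀ < y₁ →
      ∀ C : Set (ℝ × ℝ), C = Set.Icc x₀ x₁ ×ˢ Set.Icc y₀ y₁ →
      ∀ v : Fin n → ℝ × ℝ → ℝ,
        (∀ i, CakeCutting.IsValueDensity C (v i)) →
        (∀ i, 0 < CakeCutting.value (v i) C) →
        (∃ p : ℝ,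
          CakeCutting.IsPriceOfFairness C CakeCutting.parallelRectangles
            (CakeCutting.utilitarianWelfare C v) (CakeCutting.IsProportional (1 / B) C v) p ∧
          p ≤ K * Real.sqrt n) ∧
        (∃ p : ℝ,
          CakeCutting.IsPriceOfFairness C CakeCutting.parallelRectangles
            (CakeCutting.nashWelfare C v) (CakeCutting.IsProportional (1 / B) C v) p ∧
          p ≤ 11.2) := by
  refine ⟨√8, fun B hB n hn x₀ x₁ y₀ y₁ _ _ C hC v hv hpos => ?_⟩
  obtain ⟨hutil, p, hp, hp2⟩ := theorem9_general hn hB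
    ⟨_, _, Set.ordConnected_Icc, Set.ordConnected_Icc, hC⟩ (fun i => (hv i).integrableOn)
    (fun i => (hv i).nonneg) hpos
  exact ⟨by rwa [← Real.sqrt_mul (by norm_num)], p, hp, hp2.trans (by norm_num)⟩
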